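/- \textbf{Setting.} Let $O_3=\{0,\tfrac12,1\}$. A signature $\Sigma$ is a collection of connectives of finite arities (possibly including some of $\neg$, $\lor$, $\land$, $\to$); formulas over $\Sigma$ are built from a countably infinite set $P$ of propositional variables. Define operations on $O_3$ by: $\neg x=1-x$; $\tfrac12\land y=y$, $0\land y=0$, $1\land 0=0$, $1\land\tfrac12=1\land1=1$; $\tfrac12\lor y=y$, $1\lor y=1$, $0\lor1=1$, $0\lor\tfrac12=0\lor0=0$; $0\to y=\tfrac12$, and $x\to y=y$ for $x\in\{\tfrac12,1\}$. An OL-matrix $\mathbb M$ over $\Sigma$ is an algebra over $\Sigma$ on $O_3$ in which those of $\neg,\lor,\land,\to$ that belong to $\Sigma$ are interpreted by these operations (all other connectives are interpreted arbitrarily), with set of designated values $D=\{\tfrac12,1\}$. Write $\Phi\vdash^{\mathsf{biv}}_{\mathbb M}\psi$ if there is no homomorphism $v$ from the formula algebra to $\mathbb M$ with $v(p)\in\{0,1\}$ for all $p\in P$, $v[\Phi]\subseteq D$ and $v(\psi)\notin D$. \textbf{Calculi.} A rule $\frac{\Phi}{\Psi}[\Pi]$ consists of finite lists $\Phi,\Psi$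 of formulas and a set $\Pi$ of variables occurring in them (omitted if empty); its instances are obtained by the substitutions $\sigma$ with $\sigma(p)=p$ for all $p\in\Pi$. For a set $\mathsf R$ of rules, a proof of $(\Gamma,\Delta)$ is a finite tree with root labelled $\Gamma$, each of whose leaves is labelled with a set meeting $\Delta$ or with the discontinuation symbol $\star$, and in which each non-leaf node is expanded by an instance of a rule of $\mathsf R$ whose antecedent is contained in the label $\Gamma'$ of the node: the node gets one child labelled $\Gamma'\cup\{\psi\}$ for each $\psi$ in the succedent of the instance, or a single child $\star$ if the succedent is empty. $\Gamma\vdash_{\mathsf R}\psi$ means that there is a proof of $(\Gamma,\{\psi\})$. Let $\neg\in\Sigma$. The calculus $\mathsf R_\Sigma$ is the union of the sets $\mathsf R_{c}$, $c\in\Sigma$, where, with distinct variables $p,q$: - $\mathsf R_\neg$: $\frac{p}{\neg\neg p}$, $\frac{\neg\neg p}{p}$, $\frac{}{p,\ \neg p}$. - $\mathsf R_\to$: $\frac{p,\ p\to q}{q}$, $\frac{q}{p\to q}$, $\frac{}{p,\ p\to q}$, $\frac{p,\ \neg(p\to q)}{\neg q}$, $\frac{\neg q}{\neg(p\to q)}$,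 $\frac{}{p,\ \neg(p\to q)}$. - $\mathsf R_\lor$: $\frac{}{\neg p,\ p\lor q}$, $\frac{}{\neg q,\ p\lor q}$, $\frac{\neg(p\lor q)}{\neg p}$, $\frac{\neg(p\lor q)}{\neg q}$, $\frac{\neg(p\lor q),\ p\lor q}{p}$, $\frac{\neg(p\lor q),\ p\lor q}{q}$, $\frac{\neg p,\ \neg q}{\neg(p\lor q)}$, $\frac{\neg p,\ p\lor q}{q}$, $\frac{\neg q,\ p\lor q}{p}$, $\frac{p\lor q}{p,\ q}$, $\frac{p,\ q}{p\lor q}$. - $\mathsf R_\land$: $\frac{p\land q}{p}$, $\frac{p\land q}{q}$, $\frac{p,\ q}{p\land q}$, $\frac{p\land q,\ \neg(p\land q)}{\neg p}$, $\frac{p\land q,\ \neg(p\land q)}{\neg q}$, $\frac{\neg p,\ \neg q}{\neg(p\land q)}$, $\frac{p}{p\land q,\ \neg q}$, $\frac{q}{p\land q,\ \neg p}$. - For any other $k$-ary $c\in\Sigma$, with interpretation $c_{\mathbb M}$: for all $x\in O_3^k$ and all $y\in O_3$ with $y\ne c_{\mathbb M}(x)$, the rule $\frac{\Theta^+_{x_1}(p_1),\ldots,\Theta^+_{x_k}(p_k),\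 \Theta^+_y(c(p_1,\ldots,p_k))}{\Theta^-_{x_1}(p_1),\ldots,\Theta^-_{x_k}(p_k),\ \Theta^-_y(c(p_1,\ldots,p_k))}$, where $p_1,\dots,p_k$ are distinct variables, $\Theta^+_0(\varphi)=\{\neg\varphi\}$, $\Theta^+_{1/2}(\varphi)=\{\varphi,\neg\varphi\}$, $\Theta^+_1(\varphi)=\{\varphi\}$ and $\Theta^-_z(\varphi)=\{\varphi,\neg\varphi\}\setminus\Theta^+_z(\varphi)$. Put $\mathsf R^{\mathrm{OL}}_\Sigma=\mathsf R_\Sigma\cup\{\frac{p,\ \neg p}{\varnothing}[p] : p\in P\}$. \textbf{Translations.} For a binary derived connective $\oplus$, $\mathsf R^\oplus$ consists of $\frac{p\oplus p}{p}$, $\frac{p}{p\oplus q}$, $\frac{p\oplus q}{q\oplus p}$, $\frac{p\oplus(q\oplus r)}{(p\oplus q)\oplus r}$ and, for each rule $\frac{\Phi}{\Psi}[\Pi]$ of $\mathsf R$, with $p_0$ a variable not occurring in it, the rule $\frac{\{\varphi\oplus p_0\,:\,\varphi\in\Phi\}}{p_0}[\Pi]$ if $\Psi=\varnothing$; $\frac{}{\bigoplus\Psi}[\Pi]$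 if $\Phi=\varnothing\ne\Psi$; and $\frac{\{\varphi\oplus p_0\,:\,\varphi\in\Phi\}}{(\bigoplus\Psi)\oplus p_0}[\Pi]$ otherwise, where $\bigoplus\{\psi_1,\dots,\psi_n\}=\psi_1\oplus(\psi_2\oplus\cdots\oplus\psi_n)$, nested to the right. The calculus $\mathsf R^\to$ consists of $\frac{p,\ p\to q}{q}$, the axioms $p\to(q\to p)$ and $(p\to(q\to r))\to((p\to q)\to(p\to r))$ and, for each rule $\frac{\varphi_1,\dots,\varphi_m}{\psi_1,\dots,\psi_n}[\Pi]$ of $\mathsf R$, with $p_0$ a variable not occurring in it, the axiom $\varphi_1\to(\cdots(\varphi_m\to((\psi_1\to p_0)\to(\cdots((\psi_n\to p_0)\to p_0)\cdots)))\cdots)\ [\Pi]$. Finally let $\varphi\curlyvee\psi:=(\varphi\Rightarrow\psi)\Rightarrow((\psi\Rightarrow\varphi)\Rightarrow\varphi)$ with $\varphi\Rightarrow\psi:=\neg\varphi\lor\psi$. If $\land\in\Sigma$, the disjunction in this definition may be read as the abbreviation $\alpha\lor\beta:=\neg(\neg\alpha\land\neg\beta)$ (which is necessary if $\lor\notin\Sigma$).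 \textbf{Theorem.} Let $\Sigma$ be a signature with $\{\neg,\to\}\subseteq\Sigma$, $\{\neg,\lor\}\subseteq\Sigma$ or $\{\neg,\land\}\subseteq\Sigma$, and let $\mathbb M$ be an OL-matrix over $\Sigma$. Then $$\vdash^{\mathsf{biv}}_{\mathbb M}\;=\;\vdash_{(\mathsf R^{\mathrm{OL}}_\Sigma)^{©}},$$ where $©$ is $\to$ if $\to\,\in\Sigma$, and $©$ is $\curlyvee$ otherwise (under either reading of the disjunction in $\curlyvee$ that $\Sigma$ allows). -/

import Mathlib

namespace OLogic

universe u

/-- The three truth values `0`, `1/2`, `1`. -/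
inductive Val where
  | zero
  | half
  | one
  deriving DecidableEq

/-- Negation. -/
def Val.neg : Val → Val
  | .zero => .one
  | .half => .half
  | .one => .zero

/-- Quasi-conjunction. -/
def Val.and : Val → Val → Val
  | .half, y => y
  | .one, .half => .one
  | .one, y => y
  | .zero, _ => .zero

/-- Quasi-disjunction. -/
def Val.or : Val → Val → Val
  | .half, y => y
  | .one, _ => .one
  | .zero, .half => .zero
  | .zero, y => y

/-- Cooper's implication. -/
def Val.imp : Val → Val → Val
  | .zero, _ => .half
  | _, y => y

/-- The connectives `¬, ∨, ∧, →` of the logic of ordinary discourse. -/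
inductive OLConn where
  | neg
  | or
  | and
  | imp
  deriving DecidableEq

def OLConn.arity : OLConn → ℕ
  | .neg => 1
  | .or => 2
  | .and => 2
  | .imp => 2

/-- The truth tables of the connectives of the logic of ordinary discourse. -/
def OLConn.table : (c : OLConn) → (Fin c.arity → Val) → Val
  | .neg => fun x : Fin 1 → Val => (x 0).neg
  | .or => fun x : Fin 2 → Val => (x 0).or (x 1)
  | .and => fun x : Fin 2 → Val => (x 0).and (x 1)
  | .imp => fun x : Fin 2 → Val => (x 0).imp (x 1)

/-- A propositional signature `Σ`, split into `Σ ∩ {¬, ∨, ∧, →}` (the set `base`) and the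
remaining connectives `Σ \ {¬, ∨, ∧, →}` (the type `Extra`, with arbitrary finite arities). -/
structure Signature where
  base : Set OLConn
  Extra : Type u
  extraArity : Extra → ℕ

/-- All connectives of the signature. -/
def Signature.Conn (S : Signature.{u}) : Type u := S.base ⊕ S.Extra

def Signature.arity (S : Signature.{u}) : S.Conn → ℕ
  | .inl c => c.1.arity
  | .inr e => S.extraArity e

/-- Formulas over the signature: the absolutely free algebra generated by the propositional
variables `var 0, var 1, …`. -/
inductive Fml (S : Signature.{u}) : Type u where
  | var (n : ℕ) : Fml S
  | app (c : S.Conn) (args : Fin (S.arity c) → Fml S) : Fml S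

namespace Fml

variable {S : Signature.{u}}

/-- The result of applying the substitution (endomorphism) determined by `σ`. -/
def subst (σ : ℕ → Fml S) : Fml S → Fml S
  | var n => σ n
  | app c args => app c (fun i => (args i).subst σ)

/-- A strict upper bound of the indices of the variables occurring in a formula. -/
def varBound : Fml S → ℕ
  | var n => n + 1
  | app _ args => Finset.univ.sup (fun i => (args i).varBound)

def neg (h : OLConn.neg ∈ S.base) (φ : Fml S) : Fml S :=
  app (Sum.inl ⟨OLConn.neg, h⟩) (![φ] : Fin 1 → Fml S)

def or (h : OLConn.or ∈ S.base) (φ ψ : Fml S) : Fml S :=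
  app (Sum.inl ⟨OLConn.or, h⟩) (![φ, ψ] : Fin 2 → Fml S)

def and (h : OLConn.and ∈ S.base) (φ ψ : Fml S) : Fml S :=
  app (Sum.inl ⟨OLConn.and, h⟩) (![φ, ψ] : Fin 2 → Fml S)

def imp (h : OLConn.imp ∈ S.base) (φ ψ : Fml S) : Fml S :=
  app (Sum.inl ⟨OLConn.imp, h⟩) (![φ, ψ] : Fin 2 → Fml S)

/-- The disjunction defined from negation and conjunction, `φ ∨ ψ := ¬(¬φ ∧ ¬ψ)`. -/
def orOfAnd (hn : OLConn.neg ∈ S.base) (ha : OLConn.and ∈ S.base) (φ ψ : Fml S) : Fml S :=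
  neg hn (and ha (neg hn φ) (neg hn ψ))

/-- `φ ⇒ ψ := ¬φ ∨ ψ`, where `d` is the disjunction. -/
def mimp (hn : OLConn.neg ∈ S.base) (d : Fml S → Fml S → Fml S) (φ ψ : Fml S) : Fml S :=
  d (neg hn φ) ψ

/-- The derived classical-like disjunction
`φ ⋎ ψ := (φ ⇒ ψ) ⇒ ((ψ ⇒ φ) ⇒ φ)`, where `d` is the disjunction used to define `⇒`. -/
def curlyvee (hn : OLConn.neg ∈ S.base) (d : Fml S → Fml S → Fml S) (φ ψ : Fml S) : Fml S :=
  mimp hn d (mimp hn d φ ψ) (mimp hn d (mimp hn d ψ φ) φ)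

end Fml

section Semantics

variable {S : Signature.{u}}

/-- A three-valued matrix over the signature. -/
structure TMatrix (S : Signature.{u}) where
  interp : (c : S.Conn) → (Fin (S.arity c) → Val) → Val
  designated : Set Val

/-- OL-matrices: the connectives among `¬, ∨, ∧, →` have Cooper's truth tables, and exactly
`1/2` and `1` are designated. -/
structure TMatrix.IsOL (M : TMatrix S) : Prop where
  interp_base : ∀ c : S.base, M.interp (Sum.inl c) = c.1.table
  designated_eq : M.designated = {Val.half, Val.one}

/-- Valuations: homomorphisms from the formula algebra to the algebra of the matrix. -/
def TMatrix.IsValuation (M : TMatrix S) (v : Fml S → Val) : Prop :=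
  ∀ (c : S.Conn) (args : Fin (S.arity c) → Fml S),
    v (Fml.app c args) = M.interp c (fun i => v (args i))

/-- Valuations that assign only `0` or `1` to the propositional variables. -/
def TMatrix.IsBivValuation (M : TMatrix S) (v : Fml S → Val) : Prop :=
  M.IsValuation v ∧ ∀ n : ℕ, v (Fml.var n) = Val.zero ∨ v (Fml.var n) = Val.one

/-- The single-conclusion consequence determined by the bivalent-on-variables valuations. -/
def TMatrix.bivConsequence (M : TMatrix S) (Φ : Set (Fml S)) (ψ : Fml S) : Prop :=
  ¬ ∃ v : Fml S → Val, M.IsBivValuation v ∧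
    (∀ φ ∈ Φ, v φ ∈ M.designated) ∧ v ψ ∉ M.designated

end Semantics

section Calculi

variable {S : Signature.{u}}

/-- A multiple-conclusion rule `Φ / Ψ [Π]` with finite `Φ` and `Ψ`, listed in the order in which
they are written. `fixed` is the set `Π` of variables (among those of `Φ ∪ Ψ`) that
instantiation has to leave unchanged; for an ordinary rule it is empty. -/
structure Rule (S : Signature.{u}) where
  prem : List (Fml S)
  concl : List (Fml S)
  fixed : Set ℕ := ∅

/-- A Hilbert calculus is a set of rules. -/
abbrev Calculus (S : Signature.{u}) := Set (Rule S)

/-- `Proof R Γ Δ`: there is a finite proof tree in `R` whose root is labelled with `Γ` and all of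
whose leaves are discontinued or labelled with a set that meets `Δ`. A node to which a rule
instance is applied has one child for each formula of the succedent of the instance (and a single
discontinued child if the succedent is empty). -/
inductive Proof (R : Calculus S) : Set (Fml S) → Set (Fml S) → Prop where
  | leaf {Γ Δ : Set (Fml S)} (h : (Γ ∩ Δ).Nonempty) : Proof R Γ Δ
  | node {Γ Δ : Set (Fml S)} (r : Rule S) (hr : r ∈ R) (σ : ℕ → Fml S)
      (hσ : ∀ n ∈ r.fixed, σ n = Fml.var n)
      (hprem : ∀ φ ∈ r.prem, φ.subst σ ∈ Γ)
      (hconcl : ∀ ψ ∈ r.concl, Proof R (insert (ψ.subst σ) Γ) Δ) : Proof R Γ Δ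

/-- The single-conclusion companion of the derivability relation of a calculus. -/
def Derives (R : Calculus S) (Φ : Set (Fml S)) (ψ : Fml S) : Prop :=
  Proof R Φ {ψ}

/-- A propositional variable that does not occur in the rule. -/
def Rule.fresh (r : Rule S) : ℕ :=
  (r.prem ++ r.concl).foldr (fun φ n => max φ.varBound n) 0

/-- `φ₁ ⊕ (φ₂ ⊕ (… ⊕ φₙ))` for the nonempty list `φ₁ :: [φ₂, …, φₙ]`. -/
def bigOp (op : Fml S → Fml S → Fml S) : Fml S → List (Fml S) → Fml S
  | φ, [] => φ
  | φ, ψ :: l => op φ (bigOp op ψ l)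

/-- The translation `r^⊕` of a rule by means of a disjunction. -/
def Rule.disjTranslate (op : Fml S → Fml S → Fml S) (r : Rule S) : Rule S :=
  match r.prem, r.concl with
  | prem, [] =>
      { prem := prem.map (fun φ => op φ (Fml.var r.fresh))
        concl := [Fml.var r.fresh]
        fixed := r.fixed }
  | [], ψ :: l =>
      { prem := []
        concl := [bigOp op ψ l]
        fixed := r.fixed }
  | φ :: k, ψ :: l =>
      { prem := (φ :: k).map (fun χ => op χ (Fml.var r.fresh))
        concl := [op (bigOp op ψ l) (Fml.var r.fresh)]
        fixed := r.fixed }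

/-- The four rules
`p ⊕ p / p`, `p / p ⊕ q`, `p ⊕ q / q ⊕ p`, `p ⊕ (q ⊕ r) / (p ⊕ q) ⊕ r`. -/
def disjRules (op : Fml S → Fml S → Fml S) : Calculus S :=
  let p : Fml S := Fml.var 0
  let q : Fml S := Fml.var 1
  let r : Fml S := Fml.var 2
  { { prem := [op p p], concl := [p] },
    { prem := [p], concl := [op p q] },
    { prem := [op p q], concl := [op q p] },
    { prem := [op p (op q r)], concl := [op (op p q) r] } }

/-- The single-conclusion calculus `R^⊕`. -/
def disjCalculus (op : Fml S → Fml S → Fml S) (R : Calculus S) : Calculus S :=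
  disjRules op ∪ Rule.disjTranslate op '' R

/-- The formula `{φ₁, …, φₘ} ⇾ {ψ₁, …, ψₙ}` with auxiliary variable `x`, that is,
`φ₁ ⇾ (… ⇾ (φₘ ⇾ ((ψ₁ ⇾ x) ⇾ (… ⇾ ((ψₙ ⇾ x) ⇾ x)))))`. -/
def impSeq (imp : Fml S → Fml S → Fml S) (x : Fml S) : List (Fml S) → List (Fml S) → Fml S
  | [], [] => x
  | [], ψ :: l => imp (imp ψ x) (impSeq imp x [] l)
  | φ :: k, l => imp φ (impSeq imp x k l)

/-- The translation of a rule into an axiom by means of an implication. -/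
def Rule.impTranslate (imp : Fml S → Fml S → Fml S) (r : Rule S) : Rule S where
  prem := []
  concl := [impSeq imp (Fml.var r.fresh) r.prem r.concl]
  fixed := r.fixed

/-- The Hilbert calculus of intuitionistic implication: modus ponens and the two axioms
`p ⇾ (q ⇾ p)` and `(p ⇾ (q ⇾ r)) ⇾ ((p ⇾ q) ⇾ (p ⇾ r))`. -/
def impRules (imp : Fml S → Fml S → Fml S) : Calculus S :=
  let p : Fml S := Fml.var 0
  let q : Fml S := Fml.var 1
  let r : Fml S := Fml.var 2
  { { prem := [p, imp p q], concl := [q] },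
    { prem := [], concl := [imp p (imp q p)] },
    { prem := [], concl := [imp (imp p (imp q r)) (imp (imp p q) (imp p r))] } }

/-- The single-conclusion calculus `R^⇾`. -/
def impCalculus (imp : Fml S → Fml S → Fml S) (R : Calculus S) : Calculus S :=
  impRules imp ∪ Rule.impTranslate imp '' R

end Calculi

section Rules

variable {S : Signature.{u}}

/-- The multiple-conclusion rules of negation. -/
def negRules (hn : OLConn.neg ∈ S.base) : Calculus S :=
  let p : Fml S := Fml.var 0
  let n := Fml.neg hn
  { { prem := [p], concl := [n (n p)] },
    { prem := [n (n p)], concl := [p] },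
    { prem := [], concl := [p, n p] } }

/-- The multiple-conclusion rules of implication. -/
def impConnRules (hn : OLConn.neg ∈ S.base) (hi : OLConn.imp ∈ S.base) : Calculus S :=
  let p : Fml S := Fml.var 0
  let q : Fml S := Fml.var 1
  let n := Fml.neg hn
  let c := Fml.imp hi p q
  { { prem := [p, c], concl := [q] },
    { prem := [q], concl := [c] },
    { prem := [], concl := [p, c] },
    { prem := [p, n c], concl := [n q] },
    { prem := [n q], concl := [n c] },
    { prem := [], concl := [p, n c] } }

/-- The multiple-conclusion rules of quasi-disjunction. -/
def orConnRules (hn : OLConn.neg ∈ S.base) (ho : OLConn.or ∈ S.base) : Calculus S :=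
  let p : Fml S := Fml.var 0
  let q : Fml S := Fml.var 1
  let n := Fml.neg hn
  let c := Fml.or ho p q
  { { prem := [], concl := [n p, c] },
    { prem := [], concl := [n q, c] },
    { prem := [n c], concl := [n p] },
    { prem := [n c], concl := [n q] },
    { prem := [n c, c], concl := [p] },
    { prem := [n c, c], concl := [q] },
    { prem := [n p, n q], concl := [n c] },
    { prem := [n p, c], concl := [q] },
    { prem := [n q, c], concl := [p] },
    { prem := [c], concl := [p, q] },
    { prem := [p, q], concl := [c] } }

/-- The multiple-conclusion rules of quasi-conjunction. -/
def andConnRules (hn : OLConn.neg ∈ S.base) (ha : OLConn.and ∈ S.base) : Calculus S :=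
  let p : Fml S := Fml.var 0
  let q : Fml S := Fml.var 1
  let n := Fml.neg hn
  let c := Fml.and ha p q
  { { prem := [c], concl := [p] },
    { prem := [c], concl := [q] },
    { prem := [p, q], concl := [c] },
    { prem := [c, n c], concl := [n p] },
    { prem := [c, n c], concl := [n q] },
    { prem := [n p, n q], concl := [n c] },
    { prem := [p], concl := [c, n q] },
    { prem := [q], concl := [c, n p] } }

/-- The formulas among `φ, ¬φ` that are designated when `φ` has the given value. -/
def sepPos (hn : OLConn.neg ∈ S.base) : Val → Fml S → List (Fml S)
  | .zero, φ => [Fml.neg hn φ]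
  | .half, φ => [φ, Fml.neg hn φ]
  | .one, φ => [φ]

/-- The formulas among `φ, ¬φ` that are not designated when `φ` has the given value. -/
def sepNeg (hn : OLConn.neg ∈ S.base) : Val → Fml S → List (Fml S)
  | .zero, φ => [φ]
  | .half, _ => []
  | .one, φ => [Fml.neg hn φ]

/-- The rule saying that a connective `e`, applied to arguments `p₁, …, pₖ` with the values `x`,
does not take the value `y`. -/
def valueRule (hn : OLConn.neg ∈ S.base) (e : S.Extra) (x : Fin (S.extraArity e) → Val)
    (y : Val) : Rule S :=
  let c : Fml S := Fml.app (Sum.inr e) (fun i => Fml.var i.val)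
  { prem := (List.finRange (S.extraArity e)).flatMap (fun i => sepPos hn (x i) (Fml.var i.val))
      ++ sepPos hn y c
    concl := (List.finRange (S.extraArity e)).flatMap (fun i => sepNeg hn (x i) (Fml.var i.val))
      ++ sepNeg hn y c }

/-- The multiple-conclusion rules generated from the truth table of a connective outside
`¬, ∨, ∧, →` by means of the separators `p, ¬p`: one rule for each tuple of argument values and
each value that the connective does not take there. -/
def extraRules (M : TMatrix S) (hn : OLConn.neg ∈ S.base) (e : S.Extra) : Calculus S :=
  {r | ∃ (x : Fin (S.extraArity e) → Val) (y : Val),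
    y ≠ M.interp (Sum.inr e) x ∧ r = valueRule hn e x y}

/-- The multiple-conclusion calculus `R_Σ` of an OL-matrix over a signature with negation: the
union of the rules of all connectives of the signature. -/
def sOLCalculus (M : TMatrix S) (hn : OLConn.neg ∈ S.base) : Calculus S :=
  negRules hn
    ∪ (⋃ hi : OLConn.imp ∈ S.base, impConnRules hn hi)
    ∪ (⋃ ho : OLConn.or ∈ S.base, orConnRules hn ho)
    ∪ (⋃ ha : OLConn.and ∈ S.base, andConnRules hn ha)
    ∪ (⋃ e : S.Extra, extraRules M hn e)

/-- The multiple-conclusion calculus `R_Σ^OL`: the calculus `R_Σ` with the identity-instance rules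
`p, ¬p / ∅ [p]` for all propositional variables `p`. -/
def OLCalculus (M : TMatrix S) (hn : OLConn.neg ∈ S.base) : Calculus S :=
  sOLCalculus M hn ∪
    {r | ∃ n : ℕ, r = { prem := [Fml.var n, Fml.neg hn (Fml.var n)], concl := [], fixed := {n} }}

end Rules

end OLogic

/-! Soundness is semantic. Whether `φ → ψ` or `φ ⋎ ψ` is designated depends on the designation of
`φ` and `ψ` exactly as for classical implication and disjunction, so each translated rule says about
designation what the multiple-conclusion rule says. The rules `p, ¬p / ∅ [p]` hold because variables
never take the value 1/2.

Completeness is a Lindenbaum argument. If `ψ` is not derivable from `Γ`, Zorn's lemma extends `Γ` to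
a set `T` maximal among those not deriving `ψ` (`exists_relMaximal`). The key claim is that `T` is
closed under the original multiple-conclusion rules (`Respects`): if the premises of an instance lie
in `T` and no conclusion does, each conclusion added to `T` derives `ψ`, and the translated rule
combines these derivations into one of `ψ` from `T`. For `→` this rests on the deduction theorem
(`Thm.deduction`), for `⋎` on proof by cases (`Thm.disj_context`, `Thm.disj_elim`).

The pair `φ, ¬φ` separates the three values, so a closed `T` determines a function `valOfSet`.
Closure under the rules of each connective makes it a homomorphism, and closure under the
identity-instance rules makes it bivalent on variables (`Respects.isBivValuation`). It designates
exactly `T`, hence refutes `ψ`. -/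

namespace OLogic

universe u

variable {S : Signature.{u}}

/-! ### Single-conclusion derivability and relatively maximal sets -/

section Hilbert

/-- Derivability in the single-conclusion rules of a calculus. -/
inductive Thm (R : Calculus S) (Γ : Set (Fml S)) : Fml S → Prop where
  | hyp {φ : Fml S} (h : φ ∈ Γ) : Thm R Γ φ
  | rule (r : Rule S) (hr : r ∈ R) (σ : ℕ → Fml S) (hσ : ∀ n ∈ r.fixed, σ n = Fml.var n)
      (χ : Fml S) (hχ : r.concl = [χ]) (hprem : ∀ φ ∈ r.prem, Thm R Γ (φ.subst σ)) :
      Thm R Γ (χ.subst σ)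

/-- All rules of the calculus have exactly one conclusion. -/
def SingleConcl (R : Calculus S) : Prop := ∀ r ∈ R, ∃ χ, r.concl = [χ]

variable {R : Calculus S} {Γ Γ' Δ : Set (Fml S)} {φ ψ : Fml S}

theorem Thm.cut (hφ : Thm R Γ φ) (h : ∀ γ ∈ Γ, Thm R Γ' γ) : Thm R Γ' φ := by
  induction hφ with
  | hyp hm => exact h _ hm
  | rule r hr σ hσ χ hχ _ ih => exact .rule r hr σ hσ χ hχ ih

theorem Thm.mono (hφ : Thm R Γ φ) (h : Γ ⊆ Γ') : Thm R Γ' φ :=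
  hφ.cut fun _ hγ => .hyp (h hγ)

theorem Thm.cut_insert (hψ : Thm R (insert φ Γ) ψ) (hφ : Thm R Γ φ) : Thm R Γ ψ :=
  hψ.cut fun γ hγ => by
    rcases hγ with rfl | hγ
    · exact hφ
    · exact .hyp hγ

theorem Proof.mono (h : Proof R Γ Δ) : ∀ {Γ' : Set (Fml S)}, Γ ⊆ Γ' → Proof R Γ' Δ := by
  induction h with
  | leaf h => exact fun hs => .leaf (h.mono (Set.inter_subset_inter_left _ hs))
  | node r hr σ hσ hprem _ ih =>
    exact fun hs => .node r hr σ hσ (fun φ hφ => hs (hprem φ hφ))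
      fun ψ hψ => ih ψ hψ (Set.insert_subset_insert hs)

/-- With one conclusion per rule the proof tree is a single branch, which cut turns into a linear
derivation. -/
theorem Proof.thm (hR : SingleConcl R) (h : Proof R Γ Δ) : ∃ ψ ∈ Δ, Thm R Γ ψ := by
  induction h with
  | leaf h =>
    obtain ⟨ψ, h1, h2⟩ := h
    exact ⟨ψ, h2, .hyp h1⟩
  | node r hr σ hσ hprem _ ih =>
    obtain ⟨χ, hχ⟩ := hR r hr
    obtain ⟨ψ, hψ, ht⟩ := ih χ (by simp [hχ])
    exact ⟨ψ, hψ, ht.cut_insert (.rule r hr σ hσ χ hχ fun φ hφ => .hyp (hprem φ hφ))⟩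

theorem Proof.of_list (L : List (Fml S))
    (hL : ∀ φ ∈ L, ∀ Γ', Γ ⊆ Γ' → Proof R (insert φ Γ') Δ → Proof R Γ' Δ) :
    ∀ Γ', Γ ⊆ Γ' → Proof R (Γ' ∪ {φ | φ ∈ L}) Δ → Proof R Γ' Δ := by
  induction L with
  | nil => intro Γ' _ h; simpa using h
  | cons a L ih =>
    intro Γ' hs h
    refine hL a (by simp) Γ' hs (ih (fun φ hφ => hL φ (by simp [hφ])) _
      (hs.trans (Set.subset_insert _ _)) (h.mono ?_))
    rintro x (hx | hx)
    · exact .inl (.inr hx)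
    · rcases List.mem_cons.1 hx with rfl | hx
      · exact .inl (.inl rfl)
      · exact .inr hx

/-- Grafts a derivation in front of a proof tree that uses its conclusion. The label `Γ'` varies
because the premises of the last rule are added one after another, each enlarging the label for the
next. -/
theorem Thm.proof_of_insert (h : Thm R Γ φ) :
    ∀ Γ', Γ ⊆ Γ' → Proof R (insert φ Γ') Δ → Proof R Γ' Δ := by
  induction h with
  | hyp hm => intro Γ' hs h; rwa [Set.insert_eq_self.2 (hs hm)] at h
  | rule r hr σ hσ χ hχ _ ih =>
    intro Γ' hs h
    refine Proof.of_list (r.prem.map (·.subst σ)) (by simpa using ih) Γ' hs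
      (.node r hr σ hσ (fun φ hφ => .inr (List.mem_map_of_mem hφ)) ?_)
    intro ψ hψ
    obtain rfl : ψ = χ := by simpa [hχ] using hψ
    exact h.mono (Set.insert_subset_insert Set.subset_union_left)

theorem derives_iff_thm (hR : SingleConcl R) : Derives R Γ φ ↔ Thm R Γ φ := by
  constructor
  · intro h
    obtain ⟨ψ, rfl, ht⟩ := Proof.thm hR h
    exact ht
  · intro h
    exact h.proof_of_insert Γ le_rfl (.leaf ⟨φ, by simp⟩)

/-- Finitarity: a rule has finitely many premises, and in a chain the finitely many members deriving
them have a largest one. This provides the upper bounds for Zorn's lemma. -/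
theorem Thm.of_sUnion {c : Set (Set (Fml S))} (hc : IsChain (· ⊆ ·) c) (hne : c.Nonempty)
    (h : Thm R (⋃₀ c) φ) : ∃ Γ ∈ c, Thm R Γ φ := by
  induction h with
  | hyp hm =>
    obtain ⟨Γ, hΓ, hm⟩ := hm
    exact ⟨Γ, hΓ, .hyp hm⟩
  | rule r hr σ hσ χ hχ _ ih =>
    suffices H : ∀ L : List (Fml S), (∀ φ ∈ L, ∃ Γ ∈ c, Thm R Γ (φ.subst σ)) →
        ∃ Γ ∈ c, ∀ φ ∈ L, Thm R Γ (φ.subst σ) by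
      obtain ⟨Γ, hΓ, h⟩ := H _ ih
      exact ⟨Γ, hΓ, .rule r hr σ hσ χ hχ h⟩
    intro L hL
    induction L with
    | nil => exact ⟨hne.some, hne.some_mem, by simp⟩
    | cons a L ihL =>
      obtain ⟨Γ₁, h1, ha⟩ := hL a (by simp)
      obtain ⟨Γ₂, h2, hl⟩ := ihL fun φ hφ => hL φ (by simp [hφ])
      rcases hc.total h1 h2 with h | h
      · refine ⟨Γ₂, h2, fun φ hφ => ?_⟩
        rcases List.mem_cons.1 hφ with rfl | hφ
        exacts [ha.mono h, hl φ hφ]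
      · refine ⟨Γ₁, h1, fun φ hφ => ?_⟩
        rcases List.mem_cons.1 hφ with rfl | hφ
        exacts [ha, (hl φ hφ).mono h]

/-- `T` is maximal among the sets that do not derive `ψ`. -/
structure RelMaximal (R : Calculus S) (T : Set (Fml S)) (ψ : Fml S) : Prop where
  not_thm : ¬ Thm R T ψ
  thm_insert : ∀ φ ∉ T, Thm R (insert φ T) ψ

theorem exists_relMaximal (h : ¬ Thm R Γ ψ) : ∃ T, Γ ⊆ T ∧ RelMaximal R T ψ := by
  obtain ⟨T, hΓT, hT⟩ := zorn_subset_nonempty {T | ¬ Thm R T ψ}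
    (fun c hc hch hne => ⟨⋃₀ c, fun hu => by
      obtain ⟨T, hT, ht⟩ := hu.of_sUnion hch hne
      exact hc hT ht, fun T hT => Set.subset_sUnion_of_mem hT⟩) Γ h
  refine ⟨T, hΓT, hT.prop, fun φ hφ => ?_⟩
  by_contra hn
  exact hφ (hT.le_of_ge hn (Set.subset_insert _ _) (Set.mem_insert _ _))

/-- The set `T` is closed under the multiple-conclusion rules of `R`. -/
def Respects (R : Calculus S) (T : Set (Fml S)) : Prop :=
  ∀ r ∈ R, ∀ σ : ℕ → Fml S, (∀ n ∈ r.fixed, σ n = Fml.var n) →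
    (∀ φ ∈ r.prem, φ.subst σ ∈ T) → ∃ χ ∈ r.concl, χ.subst σ ∈ T

end Hilbert

/-! ### Substitutions, derived connectives and fresh variables -/

section Substitution

theorem Fml.subst_congr {σ τ : ℕ → Fml S} :
    ∀ {φ : Fml S}, (∀ n < φ.varBound, σ n = τ n) → φ.subst σ = φ.subst τ
  | .var n, h => h n (Nat.lt_succ_self n)
  | .app c args, h => by
    simp only [Fml.subst]
    congr 1
    funext i
    refine Fml.subst_congr fun n hn => h n (hn.trans_le ?_)
    exact Finset.le_sup (f := fun i => (args i).varBound) (Finset.mem_univ i)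

theorem Fml.subst_neg (h : OLConn.neg ∈ S.base) (σ : ℕ → Fml S) (φ : Fml S) :
    (Fml.neg h φ).subst σ = Fml.neg h (φ.subst σ) := by
  simp only [Fml.neg, Fml.subst]
  congr 1
  funext i
  match i with
  | (0 : Fin 1) => rfl

theorem Fml.subst_or (h : OLConn.or ∈ S.base) (σ : ℕ → Fml S) (φ ψ : Fml S) :
    (Fml.or h φ ψ).subst σ = Fml.or h (φ.subst σ) (ψ.subst σ) := by
  simp only [Fml.or, Fml.subst]
  congr 1
  funext i
  match i with
  | (0 : Fin 2) => rfl
  | (1 : Fin 2) => rfl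

theorem Fml.subst_and (h : OLConn.and ∈ S.base) (σ : ℕ → Fml S) (φ ψ : Fml S) :
    (Fml.and h φ ψ).subst σ = Fml.and h (φ.subst σ) (ψ.subst σ) := by
  simp only [Fml.and, Fml.subst]
  congr 1
  funext i
  match i with
  | (0 : Fin 2) => rfl
  | (1 : Fin 2) => rfl

theorem Fml.subst_imp (h : OLConn.imp ∈ S.base) (σ : ℕ → Fml S) (φ ψ : Fml S) :
    (Fml.imp h φ ψ).subst σ = Fml.imp h (φ.subst σ) (ψ.subst σ) := by
  simp only [Fml.imp, Fml.subst]
  congr 1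
  funext i
  match i with
  | (0 : Fin 2) => rfl
  | (1 : Fin 2) => rfl

theorem Fml.subst_orOfAnd (hn : OLConn.neg ∈ S.base) (ha : OLConn.and ∈ S.base)
    (σ : ℕ → Fml S) (φ ψ : Fml S) :
    (Fml.orOfAnd hn ha φ ψ).subst σ = Fml.orOfAnd hn ha (φ.subst σ) (ψ.subst σ) := by
  simp only [Fml.orOfAnd, Fml.subst_neg, Fml.subst_and]

/-- The derived binary connective `op` commutes with substitutions. -/
def SubstHom (op : Fml S → Fml S → Fml S) : Prop :=
  ∀ (σ : ℕ → Fml S) (φ ψ : Fml S), (op φ ψ).subst σ = op (φ.subst σ) (ψ.subst σ)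

theorem SubstHom.curlyvee {d : Fml S → Fml S → Fml S} (hd : SubstHom d)
    (hn : OLConn.neg ∈ S.base) : SubstHom (Fml.curlyvee hn d) := by
  intro σ φ ψ
  simp only [Fml.curlyvee, Fml.mimp, hd _ _ _, Fml.subst_neg]

theorem SubstHom.bigOp {op : Fml S → Fml S → Fml S} (hop : SubstHom op) (σ : ℕ → Fml S) :
    ∀ (φ : Fml S) (L : List (Fml S)),
      (bigOp op φ L).subst σ = OLogic.bigOp op (φ.subst σ) (L.map (·.subst σ))
  | _, [] => rfl
  | φ, ψ :: L => by
    simp only [OLogic.bigOp, List.map_cons, hop _ _ _, hop.bigOp σ ψ L]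

theorem SubstHom.impSeq {imp : Fml S → Fml S → Fml S} (h : SubstHom imp) (σ : ℕ → Fml S)
    (x : Fml S) : ∀ K L : List (Fml S), (impSeq imp x K L).subst σ =
      OLogic.impSeq imp (x.subst σ) (K.map (·.subst σ)) (L.map (·.subst σ))
  | [], [] => by simp [OLogic.impSeq]
  | [], ψ :: L => by
    have := h.impSeq σ x [] L
    simp only [OLogic.impSeq, List.map_cons, List.map_nil, h _ _ _] at this ⊢
    rw [this]
  | φ :: K, L => by
    have := h.impSeq σ x K L
    simp only [OLogic.impSeq, List.map_cons, h _ _ _] at this ⊢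
    rw [this]

theorem Rule.varBound_le_fresh (r : Rule S) {φ : Fml S} (h : φ ∈ r.prem ++ r.concl) :
    φ.varBound ≤ r.fresh := by
  unfold Rule.fresh
  generalize r.prem ++ r.concl = L at h
  induction L with
  | nil => exact absurd h List.not_mem_nil
  | cons a L ih =>
    rcases List.mem_cons.1 h with rfl | h
    · exact le_max_left _ _
    · exact (ih h).trans (le_max_right _ _)

/-- The fixed variables of the rules are different from the fresh variable. -/
def FreshNotFixed (R : Calculus S) : Prop := ∀ r ∈ R, r.fresh ∉ r.fixed

theorem Rule.subst_update (r : Rule S) (σ : ℕ → Fml S) (x : Fml S) {φ : Fml S}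
    (h : φ ∈ r.prem ++ r.concl) : φ.subst (Function.update σ r.fresh x) = φ.subst σ :=
  Fml.subst_congr fun _ hn =>
    Function.update_of_ne (hn.trans_le (r.varBound_le_fresh h)).ne _ _

theorem Rule.map_subst_update_prem (r : Rule S) (σ : ℕ → Fml S) (x : Fml S) :
    r.prem.map (·.subst (Function.update σ r.fresh x)) = r.prem.map (·.subst σ) :=
  List.map_congr_left fun _ h => r.subst_update σ x (List.mem_append_left _ h)

theorem Rule.map_subst_update_concl (r : Rule S) (σ : ℕ → Fml S) (x : Fml S) :
    r.concl.map (·.subst (Function.update σ r.fresh x)) = r.concl.map (·.subst σ) :=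
  List.map_congr_left fun _ h => r.subst_update σ x (List.mem_append_right _ h)

/-- Legitimises instantiating the auxiliary variable of a translated rule by an arbitrary formula,
even when the rule has fixed variables. -/
theorem update_fresh_fixed {R : Calculus S} (hR : FreshNotFixed R) {r : Rule S} (hr : r ∈ R)
    {σ : ℕ → Fml S} (hσ : ∀ n ∈ r.fixed, σ n = Fml.var n) (x : Fml S) :
    ∀ n ∈ r.fixed, Function.update σ r.fresh x n = Fml.var n := by
  intro n hn
  rw [Function.update_of_ne, hσ n hn]
  rintro rfl
  exact hR r hr hn

end Substitution

/-! ### The implicational translation: deduction theorem and closure of maximal sets -/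

section ImpCalculus

variable {imp : Fml S → Fml S → Fml S} {R : Calculus S} {Γ T : Set (Fml S)} {φ ψ χ : Fml S}

theorem singleConcl_impCalculus : SingleConcl (impCalculus imp R) := by
  rintro r ((rfl | rfl | rfl) | ⟨r, -, rfl⟩) <;> exact ⟨_, rfl⟩

theorem Thm.mp (h : SubstHom imp) (h1 : Thm (impCalculus imp R) Γ φ)
    (h2 : Thm (impCalculus imp R) Γ (imp φ ψ)) : Thm (impCalculus imp R) Γ ψ := by
  have := Thm.rule (R := impCalculus imp R) (Γ := Γ) _ (.inl (.inl rfl))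
    (fun n => if n = 0 then φ else ψ) (by simp) _ rfl
    (by simp [h _ _ _, Fml.subst, h1, h2])
  simpa [Fml.subst] using this

theorem Thm.imp_const (h : SubstHom imp) (φ ψ : Fml S) :
    Thm (impCalculus imp R) Γ (imp φ (imp ψ φ)) := by
  have := Thm.rule (R := impCalculus imp R) (Γ := Γ) _ (.inl (.inr (.inl rfl)))
    (fun n => if n = 0 then φ else ψ) (by simp) _ rfl (by simp)
  simpa [Fml.subst, h _ _ _] using this

theorem Thm.imp_distrib (h : SubstHom imp) (φ ψ χ : Fml S) : Thm (impCalculus imp R) Γ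
    (imp (imp φ (imp ψ χ)) (imp (imp φ ψ) (imp φ χ))) := by
  have := Thm.rule (R := impCalculus imp R) (Γ := Γ) _ (.inl (.inr (.inr rfl)))
    (fun n => if n = 0 then φ else if n = 1 then ψ else χ) (by simp) _ rfl (by simp)
  simpa [Fml.subst, h _ _ _] using this

theorem Thm.weaken_imp (h : SubstHom imp) (h1 : Thm (impCalculus imp R) Γ ψ) (φ : Fml S) :
    Thm (impCalculus imp R) Γ (imp φ ψ) :=
  h1.mp h (Thm.imp_const h ψ φ)

theorem Thm.mp_under (h : SubstHom imp) (h1 : Thm (impCalculus imp R) Γ (imp φ ψ))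
    (h2 : Thm (impCalculus imp R) Γ (imp φ (imp ψ χ))) :
    Thm (impCalculus imp R) Γ (imp φ χ) :=
  h1.mp h (h2.mp h (Thm.imp_distrib h φ ψ χ))

theorem Thm.imp_self (h : SubstHom imp) (φ : Fml S) :
    Thm (impCalculus imp R) Γ (imp φ φ) :=
  Thm.mp_under h (Thm.imp_const h φ φ) (Thm.imp_const h φ (imp φ φ))

/-- Modus ponens is the only rule with premises, since translated rules are axioms; so the usual
argument applies, and restrictions on instances do not interfere. -/
theorem Thm.deduction (h : SubstHom imp) (hψ : Thm (impCalculus imp R) (insert φ Γ) ψ) :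
    Thm (impCalculus imp R) Γ (imp φ ψ) := by
  induction hψ with
  | hyp hm =>
    rcases hm with rfl | hm
    · exact Thm.imp_self h _
    · exact (Thm.hyp hm).weaken_imp h φ
  | rule r hr σ hσ χ hχ hprem ih =>
    have axm : r.prem = [] → Thm (impCalculus imp R) Γ (imp φ (χ.subst σ)) := fun he =>
      (Thm.rule r hr σ hσ χ hχ (by simp [he])).weaken_imp h φ
    rcases hr with (rfl | rfl | rfl) | ⟨r, -, rfl⟩
    · obtain rfl : Fml.var 1 = χ := by simpa using hχ
      have h1 := ih (Fml.var 0) (by simp)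
      have h2 := ih (imp (Fml.var 0) (Fml.var 1)) (by simp)
      rw [h _ _ _] at h2
      exact h1.mp_under h h2
    · exact axm rfl
    · exact axm rfl
    · exact axm rfl

theorem Thm.impSeq_elim (h : SubstHom imp) {x : Fml S} : ∀ K L : List (Fml S),
    Thm (impCalculus imp R) Γ (impSeq imp x K L) →
    (∀ φ ∈ K, Thm (impCalculus imp R) Γ φ) →
    (∀ φ ∈ L, Thm (impCalculus imp R) Γ (imp φ x)) → Thm (impCalculus imp R) Γ x
  | [], [], h0, _, _ => by simpa [impSeq] using h0
  | [], ψ :: L, h0, hK, hL => by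
    simp only [impSeq] at h0
    exact Thm.impSeq_elim h [] L ((hL ψ (by simp)).mp h h0) hK
      fun φ hφ => hL φ (by simp [hφ])
  | φ :: K, L, h0, hK, hL => by
    simp only [impSeq] at h0
    exact Thm.impSeq_elim h K L ((hK φ (by simp)).mp h h0)
      (fun φ hφ => hK φ (by simp [hφ])) hL

theorem RelMaximal.respects_of_imp (h : SubstHom imp) (hR : FreshNotFixed R)
    (hT : RelMaximal (impCalculus imp R) T ψ) : Respects R T := by
  intro r hr σ hσ hprem
  by_contra! hno
  -- The auxiliary variable is instantiated by `ψ`: the premises are in `T`, and each conclusion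
  -- implies `ψ` by maximality and the deduction theorem, so detaching everything leaves `ψ`.
  have h0 := Thm.rule (R := impCalculus imp R) (Γ := T) _ (.inr ⟨r, hr, rfl⟩)
    (Function.update σ r.fresh ψ) (update_fresh_fixed hR hr hσ ψ) _ rfl
    (by simp [Rule.impTranslate])
  rw [h.impSeq, r.map_subst_update_prem, r.map_subst_update_concl] at h0
  simp only [Fml.subst, Function.update_self] at h0
  refine hT.not_thm (h0.impSeq_elim h _ _ ?_ ?_)
  · simpa using fun φ hφ => Thm.hyp (hprem φ hφ)
  · simpa using fun φ hφ => (hT.thm_insert _ (hno φ hφ)).deduction h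

end ImpCalculus

/-! ### The disjunctive translation: proof by cases and closure of maximal sets -/

section DisjCalculus

variable {op : Fml S → Fml S → Fml S} {R : Calculus S} {Γ T : Set (Fml S)} {φ ψ χ : Fml S}

theorem singleConcl_disjCalculus : SingleConcl (disjCalculus op R) := by
  rintro r ((rfl | rfl | rfl | rfl) | ⟨r, -, rfl⟩)
  · exact ⟨_, rfl⟩
  · exact ⟨_, rfl⟩
  · exact ⟨_, rfl⟩
  · exact ⟨_, rfl⟩
  · unfold Rule.disjTranslate
    split <;> exact ⟨_, rfl⟩

/-- Closure of a set of formulas under the four rules of a disjunction. -/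
structure DisjClosed (op : Fml S → Fml S → Fml S) (T : Fml S → Prop) : Prop where
  idem : ∀ {a}, T (op a a) → T a
  weak : ∀ {a} b, T a → T (op a b)
  comm : ∀ {a b}, T (op a b) → T (op b a)
  assoc : ∀ {a b c}, T (op a (op b c)) → T (op (op a b) c)

namespace DisjClosed

variable {P : Fml S → Prop} (h : DisjClosed op P) {a b c d : Fml S}
include h

theorem assoc' (H : P (op (op a b) c)) : P (op a (op b c)) :=
  h.comm (h.assoc (h.comm (h.assoc (h.comm H))))

theorem insL (c : Fml S) (H : P (op a b)) : P (op (op c a) b) :=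
  h.assoc (h.comm (h.weak c H))

theorem insR (c : Fml S) (H : P (op a b)) : P (op (op a c) b) :=
  h.comm (h.assoc' (h.weak c (h.comm H)))

/-- The disjunction rules carry no side formula, so their versions in a context `d` have to be
derived. The method, here and in `comm_ctx` and `assoc_ctx`, is to weaken until the target formula
appears twice as a disjunct and then contract by idempotence. -/
theorem idem_ctx (H : P (op (op a a) d)) : P (op a d) :=
  h.idem (h.insR d (h.assoc' H))

theorem comm_ctx (H : P (op (op a b) d)) : P (op (op b a) d) := by
  have h1 : P (op (op (op b a) d) (op b d)) := h.insR d (h.insL b (h.assoc' H))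
  have h2 : P (op b (op d (op (op b a) d))) := h.assoc' (h.comm h1)
  exact h.idem (h.assoc (h.insR a h2))

theorem assoc_ctx (H : P (op (op a (op b c)) d)) : P (op (op (op a b) c) d) := by
  have h1 : P (op (op a d) (op b c)) := h.comm_ctx (h.assoc (h.comm H))
  have h2 : P (op (op (op (op a b) c) d) (op b c)) :=
    h.assoc (h.insR c (h.insR b (h.assoc' h1)))
  have h3 : P (op b (op c (op (op (op a b) c) d))) := h.assoc' (h.comm h2)
  exact h.idem (h.insR d (h.assoc (h.insL a h3)))

end DisjClosed

theorem Rule.disjTranslate_nil {r : Rule S} (hc : r.concl = []) : r.disjTranslate op =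
    ⟨r.prem.map (fun φ => op φ (Fml.var r.fresh)), [Fml.var r.fresh], r.fixed⟩ := by
  unfold Rule.disjTranslate
  split <;> simp_all

theorem Rule.disjTranslate_axiom {r : Rule S} {L : List (Fml S)} (hp : r.prem = [])
    (hc : r.concl = χ :: L) : r.disjTranslate op = ⟨[], [bigOp op χ L], r.fixed⟩ := by
  unfold Rule.disjTranslate
  split <;> simp_all

theorem Rule.disjTranslate_cons {r : Rule S} {K L : List (Fml S)} (hp : r.prem = φ :: K)
    (hc : r.concl = χ :: L) : r.disjTranslate op =
      ⟨r.prem.map (fun φ => op φ (Fml.var r.fresh)),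
        [op (bigOp op χ L) (Fml.var r.fresh)], r.fixed⟩ := by
  unfold Rule.disjTranslate
  split <;> simp_all

theorem disjClosed_thm (h : SubstHom op) : DisjClosed op (Thm (disjCalculus op R) Γ) where
  idem {a} ha := by
    have := Thm.rule (R := disjCalculus op R) (Γ := Γ) _ (.inl (.inl rfl))
      (fun _ => a) (by simp) _ rfl (by simp [h _ _ _, Fml.subst, ha])
    simpa [Fml.subst] using this
  weak {a} b ha := by
    have := Thm.rule (R := disjCalculus op R) (Γ := Γ) _ (.inl (.inr (.inl rfl)))
      (fun n => if n = 0 then a else b) (by simp) _ rfl (by simp [Fml.subst, ha])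
    simpa [Fml.subst, h _ _ _] using this
  comm {a b} ha := by
    have := Thm.rule (R := disjCalculus op R) (Γ := Γ) _ (.inl (.inr (.inr (.inl rfl))))
      (fun n => if n = 0 then a else b) (by simp) _ rfl (by simp [h _ _ _, Fml.subst, ha])
    simpa [Fml.subst, h _ _ _] using this
  assoc {a b c} ha := by
    have := Thm.rule (R := disjCalculus op R) (Γ := Γ) _ (.inl (.inr (.inr (.inr rfl))))
      (fun n => if n = 0 then a else if n = 1 then b else c) (by simp) _ rfl
      (by simp [h _ _ _, Fml.subst, ha])
    simpa [Fml.subst, h _ _ _] using this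

theorem Thm.disj_nil (h : SubstHom op) (hR : FreshNotFixed R) {r : Rule S} (hr : r ∈ R)
    (hc : r.concl = []) {σ : ℕ → Fml S} (hσ : ∀ n ∈ r.fixed, σ n = Fml.var n) (x : Fml S)
    (hprem : ∀ φ ∈ r.prem, Thm (disjCalculus op R) Γ (op (φ.subst σ) x)) :
    Thm (disjCalculus op R) Γ x := by
  have e := Rule.disjTranslate_nil (op := op) hc
  have := Thm.rule (R := disjCalculus op R) (Γ := Γ) _ (.inr ⟨r, hr, e⟩)
    (Function.update σ r.fresh x) (update_fresh_fixed hR hr hσ x) _ rfl (by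
      simp only [List.mem_map, forall_exists_index, and_imp, forall_apply_eq_imp_iff₂]
      intro φ hφ
      rw [h _ _ _, r.subst_update σ x (List.mem_append_left _ hφ)]
      simpa [Fml.subst] using hprem φ hφ)
  simpa [Fml.subst] using this

theorem Thm.disj_cons (h : SubstHom op) (hR : FreshNotFixed R) {r : Rule S} (hr : r ∈ R)
    {χ : Fml S} {L : List (Fml S)} (hc : r.concl = χ :: L) {σ : ℕ → Fml S}
    (hσ : ∀ n ∈ r.fixed, σ n = Fml.var n) (x : Fml S)
    (hprem : ∀ φ ∈ r.prem, Thm (disjCalculus op R) Γ (op (φ.subst σ) x)) :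
    Thm (disjCalculus op R) Γ (op ((bigOp op χ L).subst σ) x) := by
  rcases hp : r.prem with _ | ⟨φ, K⟩
  · have e := Rule.disjTranslate_axiom (op := op) hp hc
    exact (disjClosed_thm h).weak x
      (Thm.rule ⟨[], [bigOp op χ L], r.fixed⟩ (.inr ⟨r, hr, e⟩) σ hσ (bigOp op χ L) rfl (by simp))
  · have e := Rule.disjTranslate_cons (op := op) hp hc
    have := Thm.rule (R := disjCalculus op R) (Γ := Γ) _ (.inr ⟨r, hr, e⟩)
      (Function.update σ r.fresh x) (update_fresh_fixed hR hr hσ x) _ rfl (by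
        simp only [List.mem_map, forall_exists_index, and_imp, forall_apply_eq_imp_iff₂]
        intro φ hφ
        rw [h _ _ _, r.subst_update σ x (List.mem_append_left _ hφ)]
        simpa [Fml.subst] using hprem φ hφ)
    have hm := r.map_subst_update_concl σ x
    rw [hc] at hm
    simp only [List.map_cons, List.cons.injEq] at hm
    rw [h _ _ _, h.bigOp, hm.1, hm.2, ← h.bigOp] at this
    simpa [Fml.subst] using this

/-- A derivation can be carried out with the disjunct `x` attached to every line. For the four
disjunction rules this is the content of the `DisjClosed` lemmas; translated rules already have room
for a context in their auxiliary variable. -/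
theorem Thm.disj_context (h : SubstHom op) (hR : FreshNotFixed R) (x : Fml S)
    (hφ : Thm (disjCalculus op R) (insert ψ Γ) φ) (hψ : Thm (disjCalculus op R) Γ (op ψ x)) :
    Thm (disjCalculus op R) Γ (op φ x) := by
  have D : DisjClosed op (Thm (disjCalculus op R) Γ) := disjClosed_thm h
  induction hφ with
  | hyp hm =>
    rcases hm with rfl | hm
    · exact hψ
    · exact D.weak x (.hyp hm)
  | rule r hr σ hσ χ hχ _ ih =>
    rcases hr with (rfl | rfl | rfl | rfl) | ⟨r, hr, rfl⟩
    · obtain rfl : Fml.var 0 = χ := by simpa using hχ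
      have := ih _ (List.mem_singleton_self _)
      simp only [h _ _ _] at this
      exact D.idem_ctx this
    · obtain rfl : op (Fml.var 0) (Fml.var 1) = χ := by simpa using hχ
      have := ih _ (List.mem_singleton_self _)
      simp only [h _ _ _] at this ⊢
      exact D.insR _ this
    · obtain rfl : op (Fml.var 1) (Fml.var 0) = χ := by simpa using hχ
      have := ih _ (List.mem_singleton_self _)
      simp only [h _ _ _] at this ⊢
      exact D.comm_ctx this
    · obtain rfl : op (op (Fml.var 0) (Fml.var 1)) (Fml.var 2) = χ := by simpa using hχ
      have := ih _ (List.mem_singleton_self _)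
      simp only [h _ _ _] at this ⊢
      exact D.assoc_ctx this
    · rcases hc : r.concl with _ | ⟨θ, L⟩
      · have e := Rule.disjTranslate_nil (op := op) hc
        rw [e] at hσ hχ ih
        obtain rfl : Fml.var r.fresh = χ := by simpa using hχ
        -- The context is absorbed by reassociating `(φ ⊕ p₀) ⊕ x` to `φ ⊕ (p₀ ⊕ x)`: the same rule
        -- is applied with `p₀ ⊕ x` as its auxiliary formula.
        refine Thm.disj_nil h hR hr hc hσ _ fun φ hφ => ?_
        have := ih _ (List.mem_map_of_mem hφ)
        rw [h _ _ _] at this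
        exact D.assoc' this
      · rcases hp : r.prem with _ | ⟨φ, K⟩
        · have e := Rule.disjTranslate_axiom (op := op) hp hc
          rw [e] at hσ hχ
          obtain rfl : bigOp op θ L = χ := by simpa using hχ
          exact Thm.disj_cons h hR hr hc hσ x (by simp [hp])
        · have e := Rule.disjTranslate_cons (op := op) hp hc
          rw [e] at hσ hχ ih
          obtain rfl : op (bigOp op θ L) (Fml.var r.fresh) = χ := by simpa using hχ
          rw [h _ _ _]
          refine D.assoc (Thm.disj_cons h hR hr hc hσ _ fun φ hφ => ?_)
          have := ih _ (List.mem_map_of_mem hφ)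
          rw [h _ _ _] at this
          exact D.assoc' this

theorem Thm.disj_elim (h : SubstHom op) (hR : FreshNotFixed R) {x : Fml S} :
    ∀ (φ : Fml S) (L : List (Fml S)),
      (∀ ψ ∈ φ :: L, Thm (disjCalculus op R) (insert ψ Γ) x) →
      Thm (disjCalculus op R) Γ (op (bigOp op φ L) x) → Thm (disjCalculus op R) Γ x
  | φ, [], hL, h0 => (disjClosed_thm h).idem (Thm.disj_context h hR x (hL φ (by simp)) h0)
  | φ, ψ :: L, hL, h0 => by
    have D : DisjClosed op (Thm (disjCalculus op R) Γ) := disjClosed_thm h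
    refine Thm.disj_elim h hR ψ L (fun χ hχ => hL χ (by simp_all)) ?_
    have h1 := Thm.disj_context h hR _ (hL φ (by simp)) (D.assoc' h0)
    -- Replacing the first case by `x` gave `x ⊕ (rest ⊕ x)`; the two copies of `x` are brought
    -- together and contracted.
    exact D.comm (D.idem_ctx (D.comm (D.assoc' (D.comm h1))))

theorem RelMaximal.respects_of_disj (h : SubstHom op) (hR : FreshNotFixed R)
    (hT : RelMaximal (disjCalculus op R) T ψ) : Respects R T := by
  intro r hr σ hσ hprem
  have D : DisjClosed op (Thm (disjCalculus op R) T) := disjClosed_thm h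
  have hp : ∀ φ ∈ r.prem, Thm (disjCalculus op R) T (op (φ.subst σ) ψ) :=
    fun φ hφ => D.weak ψ (.hyp (hprem φ hφ))
  by_contra! hno
  rcases hc : r.concl with _ | ⟨χ, L⟩
  · exact hT.not_thm (Thm.disj_nil h hR hr hc hσ ψ hp)
  · have h0 := Thm.disj_cons h hR hr hc hσ ψ hp
    rw [h.bigOp] at h0
    refine hT.not_thm (Thm.disj_elim h hR _ _ (fun θ hθ => ?_) h0)
    obtain ⟨φ, hφ, rfl⟩ : ∃ φ ∈ χ :: L, φ.subst σ = θ := List.mem_map.1 hθ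
    exact hT.thm_insert _ (hno φ (hc ▸ hφ))

end DisjCalculus


/-! ### Soundness of the rules and of their translations -/

section Soundness

variable {M : TMatrix S} {v : Fml S → Val} {R : Calculus S}

theorem TMatrix.IsOL.val_neg (hM : M.IsOL) (hv : M.IsValuation v) (h : OLConn.neg ∈ S.base)
    (φ : Fml S) : v (Fml.neg h φ) = (v φ).neg :=
  (hv (Sum.inl ⟨_, h⟩) _).trans <| (congrFun (hM.interp_base ⟨_, h⟩) _).trans rfl

theorem TMatrix.IsOL.val_or (hM : M.IsOL) (hv : M.IsValuation v) (h : OLConn.or ∈ S.base)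
    (φ ψ : Fml S) : v (Fml.or h φ ψ) = (v φ).or (v ψ) :=
  (hv (Sum.inl ⟨_, h⟩) _).trans <| (congrFun (hM.interp_base ⟨_, h⟩) _).trans rfl

theorem TMatrix.IsOL.val_and (hM : M.IsOL) (hv : M.IsValuation v) (h : OLConn.and ∈ S.base)
    (φ ψ : Fml S) : v (Fml.and h φ ψ) = (v φ).and (v ψ) :=
  (hv (Sum.inl ⟨_, h⟩) _).trans <| (congrFun (hM.interp_base ⟨_, h⟩) _).trans rfl

theorem TMatrix.IsOL.val_imp (hM : M.IsOL) (hv : M.IsValuation v) (h : OLConn.imp ∈ S.base)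
    (φ ψ : Fml S) : v (Fml.imp h φ ψ) = (v φ).imp (v ψ) :=
  (hv (Sum.inl ⟨_, h⟩) _).trans <| (congrFun (hM.interp_base ⟨_, h⟩) _).trans rfl

theorem TMatrix.IsOL.mem_designated (hM : M.IsOL) {x : Val} :
    x ∈ M.designated ↔ x ≠ .zero := by
  rw [hM.designated_eq]
  cases x <;> simp

theorem TMatrix.IsValuation.comp_subst (hv : M.IsValuation v) (σ : ℕ → Fml S) :
    M.IsValuation (fun φ => v (φ.subst σ)) :=
  fun c args => hv c fun i => (args i).subst σ

/-- The rule preserves designation in all valuations that are classical on its fixed variables. -/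
def Rule.Valid (M : TMatrix S) (r : Rule S) : Prop :=
  ∀ v : Fml S → Val, M.IsValuation v → (∀ n ∈ r.fixed, v (Fml.var n) ≠ .half) →
    (∀ φ ∈ r.prem, v φ ≠ .zero) → ∃ χ ∈ r.concl, v χ ≠ .zero

theorem Thm.sound {Γ : Set (Fml S)} {φ : Fml S} (hR : ∀ r ∈ R, r.Valid M)
    (hv : M.IsBivValuation v) (hΓ : ∀ γ ∈ Γ, v γ ≠ .zero) (h : Thm R Γ φ) : v φ ≠ .zero := by
  induction h with
  | hyp hm => exact hΓ _ hm
  | rule r hr σ hσ χ hχ _ ih =>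
    -- Validity is used at the valuation `v ∘ σ`; on fixed variables it agrees with `v`, so it is
    -- classical there.
    obtain ⟨θ, hθ, h⟩ := hR r hr _ (hv.1.comp_subst σ) (fun n hn => by
      simp only [Fml.subst, hσ n hn]
      rcases hv.2 n with h | h <;> simp [h]) ih
    rw [hχ, List.mem_singleton] at hθ
    rwa [hθ] at h

theorem forall_sepPos_and_sepNeg (hM : M.IsOL) (hv : M.IsValuation v)
    (hn : OLConn.neg ∈ S.base) {z : Val} {φ : Fml S} (h1 : ∀ χ ∈ sepPos hn z φ, v χ ≠ .zero)
    (h2 : ∀ χ ∈ sepNeg hn z φ, v χ = .zero) : v φ = z := by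
  cases z <;> cases hφ : v φ <;>
    simp_all [sepPos, sepNeg, hM.val_neg hv, Val.neg]

/-- A valuation refuting the rule would give the arguments the values `x` and the compound the value
`y`, contradicting the table. -/
theorem valid_valueRule (hM : M.IsOL) (hn : OLConn.neg ∈ S.base) (e : S.Extra)
    (x : Fin (S.extraArity e) → Val) {y : Val} (hy : y ≠ M.interp (Sum.inr e) x) :
    (valueRule hn e x y).Valid M := by
  intro v hv _ hprem
  by_contra! hno
  simp only [valueRule, List.mem_append, List.mem_flatMap, List.mem_finRange, true_and]
    at hprem hno
  have hx : (fun i : Fin (S.extraArity e) => v (Fml.var i.val)) = x := funext fun i =>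
    forall_sepPos_and_sepNeg hM hv hn (fun χ h => hprem χ (.inl ⟨i, h⟩))
      fun χ h => hno χ (.inl ⟨i, h⟩)
  have hc := forall_sepPos_and_sepNeg hM hv hn (fun χ h => hprem χ (.inr h))
    fun χ h => hno χ (.inr h)
  exact hy (hc.symm.trans ((hv (Sum.inr e) _).trans (congrArg _ hx)))

theorem valid_OLCalculus (hM : M.IsOL) (hn : OLConn.neg ∈ S.base) :
    ∀ r ∈ OLCalculus M hn, r.Valid M := by
  rintro r (((((hr | hr) | hr) | hr) | hr) | ⟨n, rfl⟩)
  · rcases hr with rfl | rfl | rfl <;> intro v hv _ <;>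
      cases h0 : v (Fml.var 0) <;> simp [hM.val_neg hv, h0, Val.neg]
  · obtain ⟨hi, hr⟩ := Set.mem_iUnion.1 hr
    rcases hr with rfl | rfl | rfl | rfl | rfl | rfl <;> intro v hv _ <;>
      cases h0 : v (Fml.var 0) <;> cases h1 : v (Fml.var 1) <;>
      simp [hM.val_neg hv, hM.val_imp hv, h0, h1, Val.neg, Val.imp]
  · obtain ⟨ho, hr⟩ := Set.mem_iUnion.1 hr
    rcases hr with rfl | rfl | rfl | rfl | rfl | rfl | rfl | rfl | rfl | rfl | rfl <;>
      intro v hv _ <;>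
      cases h0 : v (Fml.var 0) <;> cases h1 : v (Fml.var 1) <;>
      simp [hM.val_neg hv, hM.val_or hv, h0, h1, Val.neg, Val.or]
  · obtain ⟨ha, hr⟩ := Set.mem_iUnion.1 hr
    rcases hr with rfl | rfl | rfl | rfl | rfl | rfl | rfl | rfl <;> intro v hv _ <;>
      cases h0 : v (Fml.var 0) <;> cases h1 : v (Fml.var 1) <;>
      simp [hM.val_neg hv, hM.val_and hv, h0, h1, Val.neg, Val.and]
  · obtain ⟨e, x, y, hy, rfl⟩ := Set.mem_iUnion.1 hr
    exact valid_valueRule hM hn e x hy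
  · intro v hv hf
    have := hf n rfl
    cases h0 : v (Fml.var n) <;> simp_all [hM.val_neg hv, Val.neg]

theorem valid_impCalculus {imp : Fml S → Fml S → Fml S}
    (himp : ∀ v, M.IsValuation v → ∀ φ ψ, v (imp φ ψ) ≠ .zero ↔ (v φ ≠ .zero → v ψ ≠ .zero))
    (hR : ∀ r ∈ R, r.Valid M) : ∀ r ∈ impCalculus imp R, r.Valid M := by
  rintro r ((rfl | rfl | rfl) | ⟨r, hr, rfl⟩) v hv
  · simp only [List.mem_cons, List.not_mem_nil, forall_eq_or_imp, himp v hv]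
    simp
    tauto
  · simp only [List.mem_cons, List.not_mem_nil, or_false, exists_eq_left, himp v hv]
    tauto
  · simp only [List.mem_cons, List.not_mem_nil, or_false, exists_eq_left, himp v hv]
    tauto
  · have key : ∀ (x : Fml S) (K L : List (Fml S)),
        ((∀ φ ∈ K, v φ ≠ .zero) → ∃ χ ∈ L, v χ ≠ .zero) → v (impSeq imp x K L) ≠ .zero := by
      intro x K
      induction K with
      | nil =>
        intro L
        induction L with
        | nil => simp
        | cons ψ L ih =>
          intro h
          rw [impSeq, himp v hv, himp v hv]
          intro hψ
          obtain ⟨χ, hχ, hz⟩ := h (by simp)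
          rcases List.mem_cons.1 hχ with rfl | hχ
          -- Here `x` itself is designated, hence so is every remaining implication ending in `x`.
          · have hx := hψ hz
            clear * - hx himp hv
            induction L with
            | nil => simpa [impSeq] using hx
            | cons θ L ih =>
              rw [impSeq, himp v hv]
              exact fun _ => ih
          · exact ih fun _ => ⟨χ, hχ, hz⟩
      | cons φ K ih =>
        intro L h
        rw [impSeq, himp v hv]
        exact fun hφ => ih L fun hK => h (by simpa using ⟨hφ, hK⟩)
    intro hf _
    exact ⟨_, List.mem_singleton_self _, key _ _ _ (hR r hr v hv hf)⟩

theorem valid_disjCalculus {op : Fml S → Fml S → Fml S}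
    (hop : ∀ v, M.IsValuation v → ∀ φ ψ, v (op φ ψ) ≠ .zero ↔ (v φ ≠ .zero ∨ v ψ ≠ .zero))
    (hR : ∀ r ∈ R, r.Valid M) : ∀ r ∈ disjCalculus op R, r.Valid M := by
  rintro r ((rfl | rfl | rfl | rfl) | ⟨r, hr, rfl⟩) v hv
  · simp [hop v hv]
  · simp only [List.mem_cons, List.not_mem_nil, or_false, exists_eq_left, forall_eq, hop v hv]
    tauto
  · simp only [List.mem_cons, List.not_mem_nil, or_false, exists_eq_left, forall_eq, hop v hv]
    tauto
  · simp only [List.mem_cons, List.not_mem_nil, or_false, exists_eq_left, forall_eq, hop v hv]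
    tauto
  · have key : ∀ (φ : Fml S) (L : List (Fml S)),
        (∃ χ ∈ φ :: L, v χ ≠ .zero) → v (bigOp op φ L) ≠ .zero := by
      intro φ L
      induction L generalizing φ with
      | nil => simp [bigOp]
      | cons ψ L ih =>
        rintro ⟨χ, hχ, h⟩
        rw [bigOp, hop v hv]
        rcases List.mem_cons.1 hχ with rfl | hχ
        · exact .inl h
        · exact .inr (ih ψ ⟨χ, hχ, h⟩)
    have hr := hR r hr v hv
    rcases hc : r.concl with _ | ⟨χ, L⟩
    · rw [Rule.disjTranslate_nil hc]
      rw [hc] at hr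
      intro hf hp
      refine ⟨_, List.mem_singleton_self _, fun h0 => ?_⟩
      simp only [List.mem_map, forall_exists_index, and_imp, forall_apply_eq_imp_iff₂,
        hop v hv, h0] at hp
      simpa using hr hf (by simpa using hp)
    · rw [hc] at hr
      rcases hp : r.prem with _ | ⟨φ, K⟩
      · rw [Rule.disjTranslate_axiom hp hc]
        exact fun hf _ => ⟨_, List.mem_singleton_self _, key _ _ (hr hf (by simp [hp]))⟩
      · rw [Rule.disjTranslate_cons hp hc]
        intro hf hp
        refine ⟨_, List.mem_singleton_self _, ?_⟩
        rw [hop v hv, or_iff_not_imp_right]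
        intro h0
        simp only [List.mem_map, forall_exists_index, and_imp, forall_apply_eq_imp_iff₂,
          hop v hv, h0, or_false] at hp
        exact key _ _ (hr hf hp)

/-- Quasi-disjunction lacks this property, since 1/2 ∨ 0 = 0; this is why `⋎` is used for the
translation. -/
theorem val_curlyvee_ne_zero (hM : M.IsOL) (hv : M.IsValuation v) (hn : OLConn.neg ∈ S.base)
    {d : Fml S → Fml S → Fml S} (hd : ∀ φ ψ, v (d φ ψ) = (v φ).or (v ψ)) (φ ψ : Fml S) :
    v (Fml.curlyvee hn d φ ψ) ≠ .zero ↔ (v φ ≠ .zero ∨ v ψ ≠ .zero) := by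
  simp only [Fml.curlyvee, Fml.mimp, hd, hM.val_neg hv]
  cases v φ <;> cases v ψ <;> simp [Val.neg, Val.or]

end Soundness

/-! ### Completeness: the valuation of a closed set -/

section Completeness

variable {M : TMatrix S} {R : Calculus S} {T : Set (Fml S)} {hn : OLConn.neg ∈ S.base}

theorem freshNotFixed_OLCalculus : FreshNotFixed (OLCalculus M hn) := by
  rintro r (((((hr | hr) | hr) | hr) | hr) | ⟨n, rfl⟩)
  · rcases hr with rfl | rfl | rfl <;> exact id
  · obtain ⟨hi, hr⟩ := Set.mem_iUnion.1 hr
    rcases hr with rfl | rfl | rfl | rfl | rfl | rfl <;> exact id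
  · obtain ⟨ho, hr⟩ := Set.mem_iUnion.1 hr
    rcases hr with rfl | rfl | rfl | rfl | rfl | rfl | rfl | rfl | rfl | rfl | rfl <;> exact id
  · obtain ⟨ha, hr⟩ := Set.mem_iUnion.1 hr
    rcases hr with rfl | rfl | rfl | rfl | rfl | rfl | rfl | rfl <;> exact id
  · obtain ⟨e, x, y, -, rfl⟩ := Set.mem_iUnion.1 hr
    exact id
  · intro h
    have := Rule.varBound_le_fresh
      (⟨[Fml.var n, Fml.neg hn (Fml.var n)], [], {n}⟩ : Rule S) (φ := Fml.var n) (by simp)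
    rw [Set.mem_singleton_iff.1 h] at this
    exact absurd this (Nat.not_succ_le_self n)

open Classical in
/-- The valuation determined by a set of formulas through the separators `p, ¬p`. -/
noncomputable def valOfSet (hn : OLConn.neg ∈ S.base) (T : Set (Fml S)) (φ : Fml S) : Val :=
  if φ ∈ T then if Fml.neg hn φ ∈ T then .half else .one else .zero

theorem valOfSet_ne_zero {φ : Fml S} : valOfSet hn T φ ≠ .zero ↔ φ ∈ T := by
  unfold valOfSet
  split_ifs <;> simp_all

theorem mem_sepPos_subst {σ : ℕ → Fml S} {z : Val} {φ χ : Fml S} (h : χ ∈ sepPos hn z φ) :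
    χ.subst σ ∈ sepPos hn z (φ.subst σ) := by
  cases z <;> simp only [sepPos, List.mem_cons, List.not_mem_nil, or_false] at h ⊢
  · rw [h, Fml.subst_neg]
  · rcases h with rfl | rfl
    exacts [.inl rfl, .inr (Fml.subst_neg _ _ _)]
  · rw [h]

theorem mem_sepNeg_subst {σ : ℕ → Fml S} {z : Val} {φ χ : Fml S} (h : χ ∈ sepNeg hn z φ) :
    χ.subst σ ∈ sepNeg hn z (φ.subst σ) := by
  cases z <;> simp only [sepNeg, List.mem_cons, List.not_mem_nil, or_false] at h ⊢
  · rw [h]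
  · rw [h, Fml.subst_neg]

theorem sepNeg_not_mem (φ : Fml S) : ∀ χ ∈ sepNeg hn (valOfSet hn T φ) φ, χ ∉ T := by
  unfold valOfSet
  split_ifs <;> simp_all [sepNeg]

section Respects

variable (hT : Respects (OLCalculus M hn) T)
include hT

theorem Respects.neg_rules (φ : Fml S) : (φ ∈ T → Fml.neg hn (Fml.neg hn φ) ∈ T) ∧
    (Fml.neg hn (Fml.neg hn φ) ∈ T → φ ∈ T) ∧ (φ ∈ T ∨ Fml.neg hn φ ∈ T) := by
  have H : ∀ r ∈ negRules hn, _ := fun r hr =>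
    hT r (.inl (.inl (.inl (.inl (.inl hr))))) (fun _ => φ)
  simpa [negRules, Fml.subst_neg, Fml.subst] using H

theorem Respects.valOfSet_neg (φ : Fml S) :
    valOfSet hn T (Fml.neg hn φ) = (valOfSet hn T φ).neg := by
  obtain ⟨h1, h2, h3⟩ := hT.neg_rules φ
  unfold valOfSet
  split_ifs <;> simp_all [Val.neg]

theorem Respects.valOfSet_imp (hi : OLConn.imp ∈ S.base) (φ ψ : Fml S) :
    valOfSet hn T (Fml.imp hi φ ψ) = (valOfSet hn T φ).imp (valOfSet hn T ψ) := by
  have H : ∀ r ∈ impConnRules hn hi, _ := fun r hr =>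
    hT r (.inl (.inl (.inl (.inl (.inr (Set.mem_iUnion.2 ⟨hi, hr⟩))))))
      (fun n => if n = 0 then φ else ψ)
  simp [impConnRules, Fml.subst_neg, Fml.subst_imp, Fml.subst] at H
  have h1 := (hT.neg_rules φ).2.2
  have h2 := (hT.neg_rules ψ).2.2
  unfold valOfSet
  split_ifs <;> simp_all [Val.imp]

theorem Respects.valOfSet_or (ho : OLConn.or ∈ S.base) (φ ψ : Fml S) :
    valOfSet hn T (Fml.or ho φ ψ) = (valOfSet hn T φ).or (valOfSet hn T ψ) := by
  have H : ∀ r ∈ orConnRules hn ho, _ := fun r hr =>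
    hT r (.inl (.inl (.inl (.inr (Set.mem_iUnion.2 ⟨ho, hr⟩)))))
      (fun n => if n = 0 then φ else ψ)
  simp [orConnRules, Fml.subst_neg, Fml.subst_or, Fml.subst] at H
  -- The value 0 is defined by non-membership alone; excluded middle supplies the negation in `T`,
  -- so that the rules with premise `¬p` or `¬q` can act.
  have h1 := (hT.neg_rules φ).2.2
  have h2 := (hT.neg_rules ψ).2.2
  unfold valOfSet
  split_ifs <;> simp_all [Val.or]

theorem Respects.valOfSet_and (ha : OLConn.and ∈ S.base) (φ ψ : Fml S) :
    valOfSet hn T (Fml.and ha φ ψ) = (valOfSet hn T φ).and (valOfSet hn T ψ) := by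
  have H : ∀ r ∈ andConnRules hn ha, _ := fun r hr =>
    hT r (.inl (.inl (.inr (Set.mem_iUnion.2 ⟨ha, hr⟩))))
      (fun n => if n = 0 then φ else ψ)
  simp [andConnRules, Fml.subst_neg, Fml.subst_and, Fml.subst] at H
  have h1 := (hT.neg_rules φ).2.2
  have h2 := (hT.neg_rules ψ).2.2
  unfold valOfSet
  split_ifs <;> simp_all [Val.and]

theorem Respects.sepPos_mem (φ : Fml S) :
    ∀ χ ∈ sepPos hn (valOfSet hn T φ) φ, χ ∈ T := by
  have h := (hT.neg_rules φ).2.2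
  unfold valOfSet
  split_ifs <;> simp_all [sepPos]

/-- If the compound had a wrong value, the calculus would contain the rule excluding it; all
premises of the relevant instance lie in `T` and all conclusions outside, against closure. -/
theorem Respects.valOfSet_extra (e : S.Extra) (args : Fin (S.extraArity e) → Fml S) :
    valOfSet hn T (Fml.app (Sum.inr e) args) =
      M.interp (Sum.inr e) (fun i => valOfSet hn T (args i)) := by
  by_contra hne
  have hsub : ∀ i : Fin (S.extraArity e),
      (fun n => if h : n < S.extraArity e then args ⟨n, h⟩ else Fml.var n) i.val = args i :=
    fun i => dif_pos i.2
  generalize (fun n => if h : n < S.extraArity e then args ⟨n, h⟩ else Fml.var n) = σ at hsub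
  have happ : (Fml.app (Sum.inr e : S.Conn) (fun i => Fml.var i.val)).subst σ =
      Fml.app (Sum.inr e) args := by
    simp only [Fml.subst]
    exact congrArg _ (funext hsub)
  obtain ⟨χ, hχ, hm⟩ := hT (valueRule hn e (fun i => valOfSet hn T (args i))
    (valOfSet hn T (Fml.app (Sum.inr e) args)))
    (.inl (.inr (Set.mem_iUnion.2 ⟨e, _, _, hne, rfl⟩))) σ (fun n h => h.elim) (by
      intro φ hφ
      simp only [valueRule, List.mem_append, List.mem_flatMap, List.mem_finRange,
        true_and] at hφ
      rcases hφ with ⟨i, hφ⟩ | hφ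
      · exact hT.sepPos_mem _ _ (hsub i ▸ mem_sepPos_subst hφ)
      · exact hT.sepPos_mem _ _ (happ ▸ mem_sepPos_subst hφ))
  simp only [valueRule, List.mem_append, List.mem_flatMap, List.mem_finRange, true_and] at hχ
  rcases hχ with ⟨i, hχ⟩ | hχ
  · exact sepNeg_not_mem _ _ (hsub i ▸ mem_sepNeg_subst hχ) hm
  · exact sepNeg_not_mem _ _ (happ ▸ mem_sepNeg_subst hχ) hm

theorem Respects.isBivValuation (hM : M.IsOL) : M.IsBivValuation (valOfSet hn T) := by
  refine ⟨?_, fun n => ?_⟩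
  · rintro (⟨c, hc⟩ | e) args
    · rw [hM.interp_base]
      cases c with
      | neg =>
        have e : args = (![args (0 : Fin 1)] : Fin 1 → Fml S) := by
          funext i
          match i with
          | (0 : Fin 1) => rfl
        exact (congrArg (fun a => valOfSet hn T (Fml.app (Sum.inl ⟨_, hc⟩) a)) e).trans
          (hT.valOfSet_neg _)
      | or =>
        have e : args = (![args (0 : Fin 2), args (1 : Fin 2)] : Fin 2 → Fml S) := by
          funext i
          match i with
          | (0 : Fin 2) => rfl
          | (1 : Fin 2) => rfl
        exact (congrArg (fun a => valOfSet hn T (Fml.app (Sum.inl ⟨_, hc⟩) a)) e).trans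
          (hT.valOfSet_or hc _ _)
      | and =>
        have e : args = (![args (0 : Fin 2), args (1 : Fin 2)] : Fin 2 → Fml S) := by
          funext i
          match i with
          | (0 : Fin 2) => rfl
          | (1 : Fin 2) => rfl
        exact (congrArg (fun a => valOfSet hn T (Fml.app (Sum.inl ⟨_, hc⟩) a)) e).trans
          (hT.valOfSet_and hc _ _)
      | imp =>
        have e : args = (![args (0 : Fin 2), args (1 : Fin 2)] : Fin 2 → Fml S) := by
          funext i
          match i with
          | (0 : Fin 2) => rfl
          | (1 : Fin 2) => rfl
        exact (congrArg (fun a => valOfSet hn T (Fml.app (Sum.inl ⟨_, hc⟩) a)) e).trans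
          (hT.valOfSet_imp hc _ _)
    · exact hT.valOfSet_extra e args
  -- The identity instance of `p, ¬p / ∅ [p]` forbids `T` to contain both, which rules out 1/2.
  · have := hT _ (.inr ⟨n, rfl⟩) Fml.var (by simp)
    simp only [List.mem_cons, List.not_mem_nil, or_false, forall_eq_or_imp, forall_eq,
      Fml.subst_neg, Fml.subst, false_and, exists_false, imp_false, not_and] at this
    unfold valOfSet
    split_ifs <;> simp_all

end Respects

/-- The part common to both translations, which only have to supply validity of the rules and
closure of maximal sets. -/
theorem bivConsequence_eq_derives (hM : M.IsOL) (hs : SingleConcl R)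
    (hR : ∀ r ∈ R, r.Valid M)
    (hmax : ∀ T ψ, RelMaximal R T ψ → Respects (OLCalculus M hn) T) :
    M.bivConsequence = Derives R := by
  funext Γ ψ
  refine propext ?_
  rw [derives_iff_thm hs]
  constructor
  · intro h
    by_contra hψ
    obtain ⟨T, hΓ, hT⟩ := exists_relMaximal hψ
    refine h ⟨_, (hmax T ψ hT).isBivValuation hM, fun φ hφ => ?_, ?_⟩
    · rw [hM.mem_designated, valOfSet_ne_zero]
      exact hΓ hφ
    · rw [hM.mem_designated, valOfSet_ne_zero]
      exact fun h => hT.not_thm (.hyp h)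
  · rintro h ⟨v, hv, hΓ, hψ⟩
    rw [hM.mem_designated] at hψ
    exact hψ (h.sound hR hv fun φ hφ => hM.mem_designated.1 (hΓ φ hφ))

end Completeness

end OLogic

theorem mainTheorem3 {S : OLogic.Signature} (hneg : OLogic.OLConn.neg ∈ S.base)
    (M : OLogic.TMatrix S) (hM : M.IsOL) :
    (∀ himp : OLogic.OLConn.imp ∈ S.base,
      M.bivConsequence =
        OLogic.Derives
          (OLogic.impCalculus (OLogic.Fml.imp himp) (OLogic.OLCalculus M hneg))) ∧
    (OLogic.OLConn.imp ∉ S.base → ∀ hor : OLogic.OLConn.or ∈ S.base,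
      M.bivConsequence =
        OLogic.Derives
          (OLogic.disjCalculus (OLogic.Fml.curlyvee hneg (OLogic.Fml.or hor))
            (OLogic.OLCalculus M hneg))) ∧
    (OLogic.OLConn.imp ∉ S.base → ∀ hand : OLogic.OLConn.and ∈ S.base,
      M.bivConsequence =
        OLogic.Derives
          (OLogic.disjCalculus (OLogic.Fml.curlyvee hneg (OLogic.Fml.orOfAnd hneg hand))
            (OLogic.OLCalculus M hneg))) := by
  refine ⟨fun himp => ?_, fun _ hor => ?_, fun _ hand => ?_⟩
  · refine OLogic.bivConsequence_eq_derives hM OLogic.singleConcl_impCalculus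
      (OLogic.valid_impCalculus (fun v hv φ ψ => ?_) (OLogic.valid_OLCalculus hM hneg))
      fun T ψ hT => hT.respects_of_imp (OLogic.Fml.subst_imp himp)
        OLogic.freshNotFixed_OLCalculus
    rw [hM.val_imp hv]
    cases v φ <;> cases v ψ <;> simp [OLogic.Val.imp]
  · exact OLogic.bivConsequence_eq_derives hM OLogic.singleConcl_disjCalculus
      (OLogic.valid_disjCalculus (fun v hv =>
        OLogic.val_curlyvee_ne_zero hM hv hneg (hM.val_or hv hor))
        (OLogic.valid_OLCalculus hM hneg))
      fun T ψ hT => hT.respects_of_disj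
        (OLogic.SubstHom.curlyvee (OLogic.Fml.subst_or hor) hneg)
        OLogic.freshNotFixed_OLCalculus
  · refine OLogic.bivConsequence_eq_derives hM OLogic.singleConcl_disjCalculus
      (OLogic.valid_disjCalculus (fun v hv =>
        OLogic.val_curlyvee_ne_zero hM hv hneg fun φ ψ => ?_)
        (OLogic.valid_OLCalculus hM hneg))
      fun T ψ hT => hT.respects_of_disj
        (OLogic.SubstHom.curlyvee (OLogic.Fml.subst_orOfAnd hneg hand) hneg)
        OLogic.freshNotFixed_OLCalculus
    -- De Morgan: ¬(¬x ∧ ¬y) has the table of quasi-disjunction, so the computation for `⋎` is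
    -- unchanged.
    rw [OLogic.Fml.orOfAnd, hM.val_neg hv, hM.val_and hv, hM.val_neg hv, hM.val_neg hv]
    cases v φ <;> cases v ψ <;> rfl
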